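/- Let $k$ be an algebraically closed field of arbitrary characteristic and let $X$ be a proper variety over $k$ (an integral scheme, proper over $k$; not necessarily normal or projective) of dimension $n$. A $\mathbb{Q}$-Cartier divisor on $X$ is an element of $\mathrm{CaDiv}(X)\otimes_{\mathbb{Z}}\mathbb{Q}$, where $\mathrm{CaDiv}(X)=H^0(X,\mathcal{K}_X^*/\mathcal{O}_X^*)$; it is effective if some positive multiple of it is the class of an effective Cartier divisor, and $D\sim_{\mathbb{Q}}M$ means that some positive multiple of $D-M$ is the class of the divisor of a nonzero rational function. The volume of a $\mathbb{Q}$-Cartier divisor $M$ is $$\operatorname{vol}_X(M)=\limsup_{m\to+\infty}\frac{n!\,\dim_k H^0(X,\mathcal{O}_X(\lfloor mM\rfloor))}{m^n},$$ where, if $X$ is normal, $H^0(X,\mathcal{O}_X(\lfloor mM\rfloor))=\{f\in K(X): f=0\text{ or }(f)+mM\ge 0\}$, while, if $X$ is not normal, only those $m$ contribute for which $mM$ is the class of a Cartier divisor $L$, and the dimension is then the largest value of $\dim_k H^0(X,\mathcal{O}_X(L))$ over all such $L$ (they differ by torsion). For an effective $\mathbb{Q}$-Cartier divisor $D$ and a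 smooth closed point $x$, with $rD$ $(r>0)$ the class of an effective Cartier divisor with local equation $g\in\mathcal{O}_{X,x}$ at $x$, put $\operatorname{mult}_xD=\frac1r\max\{s: g\in\mathfrak{m}_x^s\}$. Let $M$ be a $\mathbb{Q}$-Cartier divisor on $X$ with $\operatorname{vol}_X(M)>n^n$ (in particular $M$ is big). Then for every smooth closed point $x\in X$ there exists an effective $\mathbb{Q}$-Cartier divisor $D$ on $X$ such that $D\sim_{\mathbb{Q}}M$ and $\operatorname{mult}_xD>n$. -/

import Mathlib

open AlgebraicGeometry CategoryTheory
open scoped TensorProduct ENNReal Nat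

universe u

noncomputable section

namespace QDivisor

section Cartier

variable (X : Scheme.{u}) [IsIntegral X]

/-- A scheme is normal if all its local rings are integrally closed. -/
def IsNormalScheme : Prop :=
  ∀ x : X, IsIntegrallyClosed (X.presheaf.stalk x)

/-- The subgroup `𝒪_{X,x}ˣ` of `K(X)ˣ`. -/
def stalkUnits (x : X) : Subgroup (X.functionField)ˣ :=
  (Units.map (algebraMap (X.presheaf.stalk x) X.functionField).toMonoidHom).range

/-- Global sections of `𝒦ˣ / 𝒪ˣ` on an integral scheme, written multiplicatively: families of
classes `D x ∈ K(X)ˣ / 𝒪_{X,x}ˣ` which locally on `X` are the classes of one rational function. -/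
def cartierSubgroup : Subgroup (∀ x : X, (X.functionField)ˣ ⧸ stalkUnits X x) where
  carrier := {D | ∀ x : X, ∃ U : X.Opens, x ∈ U ∧
    ∃ g : (X.functionField)ˣ, ∀ y ∈ U, D y = QuotientGroup.mk g}
  one_mem' := fun _ => ⟨⊤, trivial, 1, fun _ _ => rfl⟩
  mul_mem' := by
    intro D E hD hE x
    obtain ⟨U, hxU, g, hg⟩ := hD x
    obtain ⟨V, hxV, h, hh⟩ := hE x
    refine ⟨U ⊓ V, ⟨hxU, hxV⟩, g * h, fun y hy => ?_⟩
    rw [Pi.mul_apply, hg y hy.1, hh y hy.2, QuotientGroup.mk_mul]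
  inv_mem' := by
    intro D hD x
    obtain ⟨U, hxU, g, hg⟩ := hD x
    refine ⟨U, hxU, g⁻¹, fun y hy => ?_⟩
    rw [Pi.inv_apply, hg y hy, QuotientGroup.mk_inv]

/-- The group of Cartier divisors on an integral scheme, written additively. -/
def CartierDivisor : Type u := Additive (cartierSubgroup X)

instance : AddCommGroup (CartierDivisor X) :=
  inferInstanceAs (AddCommGroup (Additive (cartierSubgroup X)))

/-- The group of `ℚ`-Cartier (`ℚ`-)divisors: `ℚ ⊗ CaDiv(X)`. -/
abbrev QCartierDivisor : Type u := ℚ ⊗[ℤ] CartierDivisor X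

variable {X}

/-- The class in `K(X)ˣ / 𝒪_{X,x}ˣ` of a Cartier divisor at the point `x`. -/
def CartierDivisor.germ (L : CartierDivisor X) (x : X) :
    (X.functionField)ˣ ⧸ stalkUnits X x :=
  (Additive.toMul (α := cartierSubgroup X) L).1 x

/-- `g` is a local equation of the Cartier divisor `L` at `x`. -/
def IsLocalEquation (L : CartierDivisor X) (x : X) (g : (X.functionField)ˣ) : Prop :=
  L.germ x = QuotientGroup.mk g

/-- The rational function `f` is regular at `x`. -/
def RegularAt (x : X) (f : X.functionField) : Prop :=
  f ∈ (algebraMap (X.presheaf.stalk x) X.functionField).range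

/-- The principal Cartier divisor `(f)` of a nonzero rational function. -/
def principal (f : (X.functionField)ˣ) : CartierDivisor X :=
  Additive.ofMul (α := cartierSubgroup X) ⟨fun _ => QuotientGroup.mk f, fun _ => ⟨⊤, trivial, f, fun _ _ => rfl⟩⟩

/-- A Cartier divisor is effective if its local equations are regular functions. -/
def CartierDivisor.IsEffective (L : CartierDivisor X) : Prop :=
  ∀ (x : X) (g : (X.functionField)ˣ), IsLocalEquation L x g → RegularAt x g.1

/-- The `ℚ`-Cartier divisor given by a Cartier divisor. -/
def ofCartier (L : CartierDivisor X) : QCartierDivisor X := (1 : ℚ) ⊗ₜ[ℤ] L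

/-- `D ≥ 0`: some positive multiple of `D` is (the class of) an effective Cartier divisor. -/
def IsEffective (D : QCartierDivisor X) : Prop :=
  ∃ (r : ℕ) (L : CartierDivisor X), 0 < r ∧ L.IsEffective ∧ r • D = ofCartier L

/-- `D ∼_ℚ M`: some positive multiple of `D - M` is the divisor of a rational function. -/
def QLinearlyEquivalent (D M : QCartierDivisor X) : Prop :=
  ∃ (r : ℕ) (f : (X.functionField)ˣ), 0 < r ∧ r • (D - M) = ofCartier (principal f)

/-- The multiplicity at `x` of an effective Cartier divisor: the largest `s` such that its local
equation lies in `𝔪_x ^ s`. -/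
def cartierMult (L : CartierDivisor X) (x : X) : ℕ∞ :=
  ⨆ (s : ℕ) (_ : ∃ a ∈ IsLocalRing.maximalIdeal (X.presheaf.stalk x) ^ s,
    ∃ g : (X.functionField)ˣ, IsLocalEquation L x g ∧
      algebraMap (X.presheaf.stalk x) X.functionField a = g.1), (s : ℕ∞)

/-- The multiplicity at a regular point `x` of an effective `ℚ`-Cartier divisor `D`:
it is `mult_x(L) / r` whenever `r • D` is the class of the effective Cartier divisor `L`
(the supremum below is over numbers which are all equal when `𝒪_{X,x}` is regular). -/
def mult (D : QCartierDivisor X) (x : X) : ℝ≥0∞ :=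
  ⨆ (r : ℕ) (L : CartierDivisor X) (_ : 0 < r ∧ L.IsEffective ∧ r • D = ofCartier L),
    (cartierMult L x : ℝ≥0∞) / r

end Cartier

section Regularity

variable {X : Scheme.{u}} [IsIntegral X]

lemma isLocalEquation_iff {L : CartierDivisor X} {x : X} {g h : (X.functionField)ˣ}
    (hg : IsLocalEquation L x g) :
    IsLocalEquation L x h ↔ g⁻¹ * h ∈ stalkUnits X x := by
  unfold IsLocalEquation at *
  rw [hg, QuotientGroup.eq]

lemma exists_isLocalEquation (L : CartierDivisor X) (x : X) : ∃ g, IsLocalEquation L x g := by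
  obtain ⟨g, hg⟩ := QuotientGroup.mk_surjective (L.germ x)
  exact ⟨g, hg.symm⟩

lemma isLocalEquation_principal (f : (X.functionField)ˣ) (x : X) :
    IsLocalEquation (principal f) x f := rfl

lemma IsLocalEquation.add {L M : CartierDivisor X} {x : X} {g h : (X.functionField)ˣ}
    (hg : IsLocalEquation L x g) (hh : IsLocalEquation M x h) :
    IsLocalEquation (L + M) x (g * h) := by
  change L.germ x * M.germ x = _
  unfold IsLocalEquation at hg hh
  rw [hg, hh]
  rfl

lemma IsLocalEquation.nsmul {L : CartierDivisor X} {x : X} {g : (X.functionField)ˣ}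
    (hg : IsLocalEquation L x g) (r : ℕ) : IsLocalEquation (r • L) x (g ^ r) := by
  induction r with
  | zero => rw [zero_smul, pow_zero]; rfl
  | succ r ih => rw [succ_nsmul, pow_succ]; exact ih.add hg

lemma RegularAt.add {x : X} {f h : X.functionField} (hf : RegularAt x f) (hh : RegularAt x h) :
    RegularAt x (f + h) := add_mem hf hh

lemma RegularAt.mul {x : X} {f h : X.functionField} (hf : RegularAt x f) (hh : RegularAt x h) :
    RegularAt x (f * h) := mul_mem hf hh

lemma RegularAt.pow {x : X} {f : X.functionField} (hf : RegularAt x f) (n : ℕ) :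
    RegularAt x (f ^ n) := pow_mem hf n

lemma regularAt_of_mem_stalkUnits {x : X} {u : (X.functionField)ˣ} (hu : u ∈ stalkUnits X x) :
    RegularAt x u.1 := by
  obtain ⟨v, rfl⟩ := hu
  exact ⟨v.1, rfl⟩

/-- Whether `f * g` is regular at `x` does not depend on the local equation `g` at `x`. -/
lemma regularAt_mul_iff {L : CartierDivisor X} {x : X} {g h : (X.functionField)ˣ}
    (hg : IsLocalEquation L x g) (hh : IsLocalEquation L x h) (f : X.functionField) :
    RegularAt x (f * g) ↔ RegularAt x (f * h) := by
  have key : ∀ {a b : (X.functionField)ˣ}, IsLocalEquation L x a → IsLocalEquation L x b →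
      RegularAt x (f * a) → RegularAt x (f * b) := by
    intro a b ha hb h0
    have := h0.mul (regularAt_of_mem_stalkUnits ((isLocalEquation_iff ha).1 hb))
    rwa [Units.val_mul, mul_assoc, Units.mul_inv_cancel_left] at this
  exact ⟨key hg hh, key hh hg⟩

end Regularity

section Sections

variable {X : Scheme.{u}} [IsIntegral X] {k : Type u} [Field k]

/-- The inclusion of the constants `k → K(X)` for an integral scheme `X` over `k`. -/
def constants (π : X ⟶ Spec (.of k)) : k →+* X.functionField :=
  haveI : Nonempty (⊤ : X.Opens) := ⟨⟨genericPoint X, trivial⟩⟩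
  (X.germToFunctionField ⊤).hom.comp
    (π.appTop.hom.comp (Scheme.ΓSpecIso (.of k)).inv.hom)

lemma regularAt_constants (π : X ⟶ Spec (.of k)) (c : k) (x : X) :
    RegularAt x (constants π c) :=
  haveI : Nonempty (⊤ : X.Opens) := ⟨⟨genericPoint X, trivial⟩⟩
  ⟨X.presheaf.germ ⊤ x trivial (π.appTop ((Scheme.ΓSpecIso (.of k)).inv c)),
    X.algebraMap_germ_eq_germToFunctionField (U := ⊤) (x := x) trivial _⟩

/-- `K(X)` as a `k`-algebra, for an integral scheme `X` over `k`. -/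
abbrev functionFieldAlgebra (π : X ⟶ Spec (.of k)) : Algebra k X.functionField :=
  (constants π).toAlgebra

/-- `H⁰(X, 𝒪_X(L))` for a Cartier divisor `L`: the rational functions `f` such that `f * g` is
regular at `x` for every local equation `g` of `L` at every point `x`. -/
def sections (π : X ⟶ Spec (.of k)) (L : CartierDivisor X) :
    letI := functionFieldAlgebra π
    Submodule k X.functionField :=
  letI := functionFieldAlgebra π
  { carrier := {f | ∀ (x : X) (g : (X.functionField)ˣ), IsLocalEquation L x g →
      RegularAt x (f * g)}
    zero_mem' := fun x g _ => by rw [zero_mul]; exact zero_mem _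
    add_mem' := fun {a b} ha hb x g hg => by
      rw [add_mul]; exact (ha x g hg).add (hb x g hg)
    smul_mem' := fun c f hf x g hg => by
      rw [Algebra.smul_def, mul_assoc]
      exact (regularAt_constants π c x).mul (hf x g hg) }

/-- `f = 0` or `(f) + E ≥ 0`. On a normal variety these are the sections of `𝒪_X(⌊E⌋)`
(the divisor of a rational function has integral coefficients). -/
def IsRoundDownSection (E : QCartierDivisor X) (f : X.functionField) : Prop :=
  f = 0 ∨ ∃ u : (X.functionField)ˣ, u.1 = f ∧ IsEffective (ofCartier (principal u) + E)

lemma ofCartier_add (L M : CartierDivisor X) :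
    ofCartier (L + M) = ofCartier L + ofCartier M := TensorProduct.tmul_add _ _ _

lemma ofCartier_nsmul (r : ℕ) (L : CartierDivisor X) :
    ofCartier (r • L) = r • ofCartier L := TensorProduct.tmul_smul _ _ _

lemma ofCartier_sub (L M : CartierDivisor X) :
    ofCartier (L - M) = ofCartier L - ofCartier M := TensorProduct.tmul_sub _ _ _

lemma exists_nsmul_eq_of_ofCartier_eq {L M : CartierDivisor X}
    (h : ofCartier L = ofCartier M) : ∃ r : ℕ, 0 < r ∧ r • L = r • M := by
  have h0 : TensorProduct.mk ℤ ℚ (CartierDivisor X) 1 L =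
    TensorProduct.mk ℤ ℚ (CartierDivisor X) 1 M := h
  rw [IsLocalizedModule.eq_iff_exists (nonZeroDivisors ℤ)] at h0
  obtain ⟨c, hc⟩ := h0
  have hc' : (c : ℤ) • L = (c : ℤ) • M := hc
  have hne : (c : ℤ) ≠ 0 := nonZeroDivisors.coe_ne_zero c
  refine ⟨(c : ℤ).natAbs, Int.natAbs_pos.2 hne, ?_⟩
  rcases Int.natAbs_eq (c : ℤ) with h | h <;> rw [h] at hc'
  · rwa [natCast_zsmul, natCast_zsmul] at hc'
  · rwa [neg_zsmul, neg_zsmul, neg_inj, natCast_zsmul, natCast_zsmul] at hc'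

lemma exists_ofCartier_eq (E : QCartierDivisor X) :
    ∃ (r : ℕ) (L : CartierDivisor X), 0 < r ∧ r • E = ofCartier L := by
  induction E using TensorProduct.induction_on with
  | zero => exact ⟨1, 0, one_pos, by rw [smul_zero]; exact (TensorProduct.tmul_zero _ _).symm⟩
  | tmul q L =>
    refine ⟨q.den, q.num • L, q.den_pos, ?_⟩
    rw [ofCartier, ← TensorProduct.smul_tmul, TensorProduct.smul_tmul']
    congr 1
    rw [nsmul_eq_mul, mul_comm, Rat.mul_den_eq_num, zsmul_eq_mul, mul_one]
  | add E F hE hF =>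
    obtain ⟨r, L, hr, hL⟩ := hE
    obtain ⟨s, M, hs, hM⟩ := hF
    refine ⟨r * s, s • L + r • M, Nat.mul_pos hr hs, ?_⟩
    rw [ofCartier_add, ofCartier_nsmul, ofCartier_nsmul, ← hL, ← hM, smul_add, smul_smul,
      smul_smul, mul_comm s r]

/-- `f` is a section of the round-down of `E` iff `f ^ N ∈ H⁰(X, 𝒪_X(B))` for some `N > 0` and
some Cartier divisor `B` representing `N • E`. -/
lemma isRoundDownSection_iff (E : QCartierDivisor X) (f : X.functionField) :
    IsRoundDownSection E f ↔ ∃ (N : ℕ) (B : CartierDivisor X), 0 < N ∧ N • E = ofCartier B ∧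
      ∀ (x : X) (g : (X.functionField)ˣ), IsLocalEquation B x g → RegularAt x (f ^ N * g) := by
  constructor
  · rintro (rfl | ⟨u, rfl, N, L, hN, hL, h⟩)
    · obtain ⟨N, B, hN, hB⟩ := exists_ofCartier_eq E
      refine ⟨N, B, hN, hB, fun x g _ => ?_⟩
      rw [zero_pow hN.ne', zero_mul]
      exact zero_mem _
    · refine ⟨N, L - N • principal u, hN, ?_, fun x g hg => ?_⟩
      · rw [ofCartier_sub, ofCartier_nsmul, ← h, smul_add]
        abel
      · have := ((isLocalEquation_principal u x).nsmul N).add hg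
        rw [add_sub_cancel] at this
        simpa using hL x _ this
  · rintro ⟨N, B, hN, hB, h⟩
    by_cases hf : f = 0
    · exact Or.inl hf
    · refine Or.inr ⟨Units.mk0 f hf, rfl, N, N • principal (Units.mk0 f hf) + B, hN, ?_, ?_⟩
      · intro x g hg
        obtain ⟨b, hb⟩ := exists_isLocalEquation B x
        have h1 := ((isLocalEquation_principal (Units.mk0 f hf) x).nsmul N).add hb
        have h2 := h x b hb
        have h3 : RegularAt x (1 * ((Units.mk0 f hf ^ N * b : (X.functionField)ˣ) :
            X.functionField)) := by simpa using h2
        simpa using (regularAt_mul_iff h1 hg 1).1 h3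
      · rw [ofCartier_add, ofCartier_nsmul, smul_add, hB]

lemma regularAt_add_pow_mul (hX : IsNormalScheme X) {x : X} {N : ℕ} (hN : 0 < N)
    {f h g : X.functionField} (hf : RegularAt x (f ^ N * g)) (hh : RegularAt x (h ^ N * g)) :
    RegularAt x ((f + h) ^ N * g) := by
  have := hX x
  rw [add_pow, Finset.sum_mul]
  refine sum_mem fun i hi => ?_
  have hi' : i ≤ N := Nat.lt_succ_iff.1 (Finset.mem_range.1 hi)
  have key : RegularAt x (f ^ i * h ^ (N - i) * g) := by
    have h1 : RegularAt x ((f ^ i * h ^ (N - i) * g) ^ N) := by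
      have h2 : (f ^ i * h ^ (N - i) * g) ^ N =
          (f ^ N * g) ^ i * (h ^ N * g) ^ (N - i) := by
        have : g ^ N = g ^ i * g ^ (N - i) := by rw [← pow_add, Nat.add_sub_cancel' hi']
        rw [mul_pow, this]
        ring
      rw [h2]
      exact (hf.pow i).mul (hh.pow (N - i))
    obtain ⟨a, ha⟩ := h1
    have hint : IsIntegral (X.presheaf.stalk x) (f ^ i * h ^ (N - i) * g) :=
      IsIntegral.of_pow hN (ha ▸ isIntegral_algebraMap)
    exact IsIntegrallyClosed.isIntegral_iff.1 hint
  have hc : RegularAt x ((N.choose i : ℕ) : X.functionField) := natCast_mem _ _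
  have hmul := hc.mul key
  rwa [← mul_assoc, mul_comm ((N.choose i : ℕ) : X.functionField)] at hmul

/-- `H⁰(X, 𝒪_X(⌊E⌋))` for a `ℚ`-Cartier divisor `E` on a normal variety `X`. -/
def roundDownSections (π : X ⟶ Spec (.of k)) (hX : IsNormalScheme X) (E : QCartierDivisor X) :
    letI := functionFieldAlgebra π
    Submodule k X.functionField :=
  letI := functionFieldAlgebra π
  { carrier := {f | IsRoundDownSection E f}
    zero_mem' := Or.inl rfl
    add_mem' := fun {a b} ha hb => by
      obtain ⟨N, B, hN, hB, h⟩ := (isRoundDownSection_iff E a).1 ha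
      obtain ⟨N', B', hN', hB', h'⟩ := (isRoundDownSection_iff E b).1 hb
      obtain ⟨r, hr, hBB⟩ := exists_nsmul_eq_of_ofCartier_eq
        (L := N' • B) (M := N • B') (by
          rw [ofCartier_nsmul, ofCartier_nsmul, ← hB, ← hB', smul_smul, smul_smul, mul_comm])
      refine (isRoundDownSection_iff E (a + b)).2
        ⟨r * (N' * N), r • N' • B, Nat.mul_pos hr (Nat.mul_pos hN' hN), ?_, fun x g hg => ?_⟩
      · rw [ofCartier_nsmul, ofCartier_nsmul, ← hB, smul_smul, smul_smul, mul_assoc]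
      · obtain ⟨c, hc⟩ := exists_isLocalEquation B x
        obtain ⟨c', hc'⟩ := exists_isLocalEquation B' x
        have e1 := (hc.nsmul N').nsmul r
        have e2 := (hc'.nsmul N).nsmul r
        rw [← hBB] at e2
        refine regularAt_add_pow_mul hX (Nat.mul_pos hr (Nat.mul_pos hN' hN)) ?_ ?_
        · rw [regularAt_mul_iff hg e1]
          have e : a ^ (r * (N' * N)) * ((((c ^ N') ^ r : (X.functionField)ˣ)) : X.functionField) =
              ((a ^ N * c) ^ N') ^ r := by
            push_cast
            ring
          rw [e]
          exact ((h x c hc).pow N').pow r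
        · rw [regularAt_mul_iff hg e2]
          have e : b ^ (r * (N' * N)) * ((((c' ^ N) ^ r : (X.functionField)ˣ)) : X.functionField) =
              ((b ^ N' * c') ^ N) ^ r := by
            push_cast
            ring
          rw [e]
          exact ((h' x c' hc').pow N).pow r
    smul_mem' := fun c f hf => by
      obtain ⟨N, B, hN, hB, h⟩ := (isRoundDownSection_iff E f).1 hf
      refine (isRoundDownSection_iff E _).2 ⟨N, B, hN, hB, fun x g hg => ?_⟩
      rw [Algebra.smul_def, mul_pow, mul_assoc]
      exact ((regularAt_constants π c x).pow N).mul (h x g hg) }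

/-- `dim_k H⁰(X, 𝒪_X(L))` for a Cartier divisor `L`. -/
def h0 (π : X ⟶ Spec (.of k)) (L : CartierDivisor X) : ℕ∞ :=
  letI := functionFieldAlgebra π
  Cardinal.toENat (Module.rank k (sections π L))

open Classical in
/-- `dim_k H⁰(X, 𝒪_X(⌊E⌋))` for a `ℚ`-Cartier divisor `E`. On a normal variety the round-down is
that of Weil divisors. On a variety which is not normal only integral divisors have an associated
sheaf: there we take `dim_k H⁰(X, 𝒪_X(L))` if `E` is (the class of) a Cartier divisor `L`
(the largest of these numbers, as `E` determines `L` only up to torsion), and `0` otherwise. -/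
def h0RoundDown (π : X ⟶ Spec (.of k)) (E : QCartierDivisor X) : ℕ∞ :=
  letI := functionFieldAlgebra π
  if hX : IsNormalScheme X then Cardinal.toENat (Module.rank k (roundDownSections π hX E))
  else ⨆ (L : CartierDivisor X) (_ : ofCartier L = E), h0 π L

/-- The volume `limsup_m n! h⁰(X, 𝒪_X(⌊m D⌋)) / m ^ n` of a `ℚ`-Cartier divisor on an
`n`-dimensional variety. -/
def volume (π : X ⟶ Spec (.of k)) (n : ℕ) (D : QCartierDivisor X) : ℝ≥0∞ :=
  Filter.limsup (fun m : ℕ => (n ! : ℝ≥0∞) * (h0RoundDown π (m • D) : ℝ≥0∞) / (m : ℝ≥0∞) ^ n)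
    Filter.atTop

end Sections

end QDivisor

end

/-! The proof counts conditions. At a smooth closed point at most `n` elements generate `𝔪_x` modulo
`𝔪_x²`, so vanishing to order `s + 1` at `x` costs at most `(n + s).choose s` linear conditions
(`Ideal.rank_quotient_pow_succ_le`). For `s = m n + C` with `C` fixed this is asymptotic to `n ^ n m
^ n / n!`. Hence volume above `n ^ n` gives some `m > 0` with more sections of `m M` than conditions
(`exists_choose_lt_of_pow_lt_limsup`), and so a nonzero section `f` vanishing to order greater than
`m n`. The divisor `M + (1/m)(f)` is then the required one (`QDivisor.exists_effective_of_section`).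

If `X` is not normal, `m M` is the class of a Cartier divisor and `C = 0` suffices. If `X` is
normal, the round-down of `m M` need not be invertible at `x`, so vanishing has to be measured
indirectly. Let `r M` be the class of a Cartier divisor `B` with local equation `b` at `x`.
`QDivisor.exists_const_forall_roundDownSection` supplies, for each `m`, a multiplier `h` that makes
every section regular at `x`, such that `f h ∈ 𝔪_x ^ s` forces `f ^ r b ^ m ∈ 𝔪_x ^ (s r - c)`. The
loss `c` comes from Artin–Rees and does not depend on `m`, so the choice `C = c` absorbs it. -/

/-! ### Dimension and cotangent spaces of standard smooth algebras -/

lemma MvPolynomial.height_eq_card_of_isMaximal {k : Type*} [Field k] {ι : Type*} [Finite ι]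
    (P : Ideal (MvPolynomial ι k)) [hP : P.IsMaximal] : P.height = Nat.card ι := by
  induction ι using Finite.induction_empty_option with
  | of_equiv e H =>
    have := Ideal.comap_isMaximal_of_surjective (renameEquiv k e).toRingEquiv
      (renameEquiv k e).surjective (K := P)
    rw [← Nat.card_congr e, ← H (P.comap (renameEquiv k e).toRingEquiv), RingEquiv.height_comap]
  | h_empty =>
    have : IsField (MvPolynomial PEmpty k) :=
      (isEmptyRingEquiv k PEmpty).toMulEquiv.isField (Field.toIsField k)
    let := this.toField
    rw [Ideal.eq_bot_of_prime P]
    simp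
  | h_option IH =>
    rename_i ι _
    let e := (optionEquivLeft k ι).toRingEquiv
    let Q := P.comap e.symm
    have hQ : Q.IsMaximal := Ideal.comap_isMaximal_of_surjective e.symm e.symm.surjective (K := P)
    -- Over a Jacobson ring the contraction of a maximal ideal is again maximal, so induction
    -- applies to it, and the last variable adds exactly one to the height.
    have hQC : (Q.under (MvPolynomial ι k)).IsMaximal :=
      Polynomial.isMaximal_comap_C_of_isJacobsonRing Q
    have hlo : Q.LiesOver (Q.under (MvPolynomial ι k)) := ⟨rfl⟩
    have h1 := Polynomial.height_eq_height_add_one (Q.under (MvPolynomial ι k)) Q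
    rw [IH, RingEquiv.height_comap] at h1
    rw [h1]
    simp

/-- Krull's height theorem: a maximal ideal of the polynomial ring has height `card ι`, and dividing
by `card σ` relations lowers the dimension by at most `card σ`. -/
lemma Algebra.SubmersivePresentation.dimension_le_ringKrullDim {k S ι σ : Type*} [Field k]
    [CommRing S] [Algebra k S] [Nontrivial S] [Finite ι] [Finite σ]
    (P : Algebra.SubmersivePresentation k S ι σ) :
    (P.dimension : WithBot ℕ∞) ≤ ringKrullDim S := by
  classical
  obtain ⟨m, hm⟩ := Ideal.exists_maximal S
  have hsurj : Function.Surjective (algebraMap P.Ring S) := P.algebraMap_surjective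
  have hker : Ideal.span (Set.range P.relation) = RingHom.ker (algebraMap P.Ring S) :=
    P.span_range_relation_eq_ker
  let Q : Ideal (MvPolynomial ι k) := m.comap (algebraMap P.Ring S)
  have hQ : Q.IsMaximal := Ideal.comap_isMaximal_of_surjective _ hsurj
  have hle : Set.range P.relation ⊆ Q := by
    rw [← Ideal.span_le, hker]
    exact Ideal.comap_mono bot_le
  have h1 := Ideal.height_le_ringKrullDim_quotient_add_encard _ hle
  rw [MvPolynomial.height_eq_card_of_isMaximal] at h1
  have e := (Ideal.quotEquivOfEq hker).trans (RingHom.quotientKerEquivOfSurjective hsurj)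
  rw [ringKrullDim_eq_of_ringEquiv e] at h1
  have h2 : ((Set.range P.relation).encard : WithBot ℕ∞) ≤ (Nat.card σ : WithBot ℕ∞) := by
    rw [← Set.image_univ]
    have := (Set.encard_image_le P.relation Set.univ)
    rw [Set.encard_univ, ENat.card_eq_coe_natCard] at this
    exact_mod_cast this
  have h3 : (Nat.card ι : WithBot ℕ∞) ≤ ringKrullDim S + Nat.card σ :=
    h1.trans (by gcongr)
  rw [Algebra.Presentation.dimension]
  have h4 := Nat.card_le_card_of_injective P.map P.map_inj
  generalize ringKrullDim S = D at h3
  induction D with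
  | bot => exact absurd h3 (by simp)
  | coe D =>
    induction D using ENat.recTopCoe with
    | top => exact le_top
    | coe D =>
      have h6 : Nat.card ι ≤ D + Nat.card σ := by exact_mod_cast h3
      exact Nat.cast_le (α := WithBot ℕ∞).2 (by omega)

open KaehlerDifferential in
-- The residue field is `k`, so `a ↦ a - a(m)` induces a derivation `S → m/m²` which on `m` is the
-- canonical projection. It factors through the Kähler differentials, which are free of rank
-- `P.dimension`, so the images of a basis span `m/m²`.
lemma Algebra.IsStandardSmooth.exists_eq_span_sup_sq {k S : Type*} [Field k] [CommRing S]
    [Algebra k S] [Algebra.IsStandardSmooth k S] (m : Ideal S) [m.IsMaximal]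
    (hm : Function.Surjective (algebraMap k (S ⧸ m))) :
    ∃ (d : ℕ) (y : Fin d → S), (d : WithBot ℕ∞) ≤ ringKrullDim S ∧
      m = Ideal.span (Set.range y) ⊔ m ^ 2 := by
  classical
  have : Nontrivial S := nontrivial_of_ne 0 1 fun h ↦
    (Ideal.ne_top_iff_one m).1 (Ideal.IsMaximal.ne_top ‹_›) (h ▸ m.zero_mem)
  obtain ⟨ι, σ, _, _, ⟨P⟩⟩ := ‹Algebra.IsStandardSmooth k S›
  let e : k ≃ₐ[k] S ⧸ m := AlgEquiv.ofBijective (Algebra.ofId k (S ⧸ m))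
    ⟨(algebraMap k (S ⧸ m)).injective, hm⟩
  let ε : S →ₐ[k] k := e.symm.toAlgHom.comp (Ideal.Quotient.mkₐ k m)
  have hε (a : S) : a - algebraMap k S (ε a) ∈ m := by
    rw [← Ideal.Quotient.mk_eq_mk_iff_sub_mem]
    exact (e.apply_symm_apply (Ideal.Quotient.mk m a)).symm
  have hε0 (a : S) (ha : a ∈ m) : ε a = 0 := by
    simp [ε, Ideal.Quotient.eq_zero_iff_mem.mpr ha]
  let D : Derivation k S m.Cotangent :=
    Derivation.mk'
      { toFun := fun a ↦ m.toCotangent ⟨_, hε a⟩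
        map_add' := fun a b ↦ by
          rw [← map_add]; congr 1; ext; simp; ring
        map_smul' := fun c a ↦ by
          rw [RingHom.id_apply, ← algebraMap_smul S c (m.toCotangent _), ← map_smul]
          congr 1; ext; simp [Algebra.smul_def]; ring }
      (fun a b ↦ by
        change m.toCotangent _ = a • m.toCotangent _ + b • m.toCotangent _
        rw [← map_smul, ← map_smul, ← map_add, Ideal.toCotangent_eq]
        -- The defect in the Leibniz rule is exactly this product of two elements of `m`.
        have : -((a - algebraMap k S (ε a)) * (b - algebraMap k S (ε b))) ∈ m ^ 2 := by
          rw [neg_mem_iff, pow_two]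
          exact Ideal.mul_mem_mul (hε a) (hε b)
        convert this using 1
        simp
        ring)
  have hD (a : m) : D a = m.toCotangent a := by
    change m.toCotangent _ = _
    congr 1
    ext
    simp [hε0 a a.2]
  let b := P.basisKaehler
  have hcard : Nat.card ((Set.range P.map)ᶜ : Set ι) = P.dimension := by
    have h1 := P.rank_kaehlerDifferential
    rw [← Module.finrank_eq_nat_card_basis b]
    exact Module.finrank_eq_of_rank_eq h1
  let f := (Finite.equivFinOfCardEq hcard).symm
  have hsurj (i : Fin P.dimension) := m.toCotangent_surjective (D.liftKaehlerDifferential (b (f i)))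
  choose y hy using hsurj
  refine ⟨P.dimension, fun i ↦ y i, P.dimension_le_ringKrullDim, le_antisymm ?_ (sup_le ?_ ?_)⟩
  · intro a ha
    have h1 : m.toCotangent ⟨a, ha⟩ = D.liftKaehlerDifferential (KaehlerDifferential.D k S a) := by
      rw [Derivation.liftKaehlerDifferential_comp_D, hD ⟨a, ha⟩]
    -- Expanding `da` in the basis writes the class of `a` in `m/m²` through the `y i`.
    rw [← (b.reindex f.symm).sum_repr (KaehlerDifferential.D k S a), map_sum] at h1
    simp only [map_smul, Module.Basis.reindex_apply, Equiv.symm_symm, ← hy] at h1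
    simp only [← map_smul, ← map_sum] at h1
    rw [Ideal.toCotangent_eq] at h1
    rw [← sub_add_cancel a]
    refine add_mem (Ideal.mem_sup_right h1) (Ideal.mem_sup_left ?_)
    simp only [Submodule.coe_sum, Submodule.coe_smul]
    exact sum_mem fun i _ ↦ Ideal.mul_mem_left _ _ (Ideal.subset_span ⟨i, rfl⟩)
  · rw [Ideal.span_le]
    rintro _ ⟨i, rfl⟩
    exact (y i).2
  · exact Ideal.pow_le_self two_ne_zero

/-! ### Counting the conditions for vanishing to a given order -/

lemma Set.range_pow_subset_range_sym {α R : Type*} [CommMonoid R] (z : α → R) (s : ℕ) :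
    letI := Set.monoid (α := R)
    Set.range z ^ s ⊆ Set.range fun t : Sym α s ↦ (t.1.map z).prod := by
  let := Set.monoid (α := R)
  induction s with
  | zero => rintro _ rfl; exact ⟨Sym.nil, by simp⟩
  | succ s ih =>
    rw [pow_succ']
    rintro _ ⟨_, ⟨a, rfl⟩, b, hb, rfl⟩
    obtain ⟨t, rfl⟩ := ih hb
    exact ⟨a ::ₛ t, by simp [Sym.coe_cons]⟩

/-- If `I` is generated modulo `I ^ 2` by `n` elements and `k → R ⧸ I` is surjective, then
`R ⧸ I ^ (s + 1)` is spanned by the monomials of degree at most `s` in the generators. -/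
lemma Ideal.rank_quotient_pow_succ_le {k R : Type*} [Field k] [CommRing R] [Algebra k R]
    (I : Ideal R) (hI : Function.Surjective (algebraMap k (R ⧸ I))) {n : ℕ} (y : Fin n → R)
    (hy : I = Ideal.span (Set.range y) ⊔ I ^ 2) (s : ℕ) :
    Module.rank k (R ⧸ I ^ (s + 1)) ≤ ((n + s).choose s : ℕ) := by
  classical
  have hc (a : R) : ∃ c : k, a - algebraMap k R c ∈ I := by
    obtain ⟨c, hc⟩ := hI (Ideal.Quotient.mk I a)
    exact ⟨c, Ideal.Quotient.mk_eq_mk_iff_sub_mem _ _ |>.mp hc.symm⟩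
  let J (i : ℕ) : Submodule k R := (I ^ i).restrictScalars k
  let W' : Submodule k R := Submodule.span k (Set.range y)
  have hyI (i) : y i ∈ I := by
    rw [hy]; exact Ideal.mem_sup_left (Ideal.subset_span ⟨i, rfl⟩)
  -- Coefficients may be replaced by constants, as the error lies in `I * I`.
  have h1 : J 1 ≤ W' ⊔ J 2 := by
    intro a ha
    have ha : a ∈ I := by simpa [J] using ha
    rw [hy] at ha
    obtain ⟨b, hb, j, hj, rfl⟩ := Submodule.mem_sup.1 ha
    refine add_mem ?_ (Submodule.mem_sup_right hj)
    obtain ⟨r, rfl⟩ := (Submodule.mem_span_range_iff_exists_fun R).1 hb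
    refine Submodule.sum_mem _ fun i _ ↦ ?_
    obtain ⟨c, hc⟩ := hc (r i)
    rw [smul_eq_mul, ← sub_add_cancel (r i) (algebraMap k R c), add_mul]
    refine add_mem (Submodule.mem_sup_right ?_) (Submodule.mem_sup_left ?_)
    · change _ ∈ I ^ 2
      rw [pow_two]
      exact Ideal.mul_mem_mul hc (hyI i)
    · rw [← Algebra.smul_def]
      exact Submodule.smul_mem _ _ (Submodule.subset_span ⟨i, rfl⟩)
  have h2 (s : ℕ) : J s ≤ W' ^ s ⊔ J (s + 1) := by
    induction s with
    | zero =>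
      intro a _
      obtain ⟨c, hc⟩ := hc a
      rw [← sub_add_cancel a (algebraMap k R c)]
      refine add_mem (Submodule.mem_sup_right ?_) (Submodule.mem_sup_left ?_)
      · simpa [J] using hc
      · rw [pow_zero]; exact Submodule.mem_one.2 ⟨c, rfl⟩
    | succ s ih =>
      intro a ha
      have ha : a ∈ I ^ s * I := by rw [← pow_succ]; exact ha
      refine Submodule.mul_induction_on ha (fun b hb c hc ↦ ?_) fun _ _ ↦ add_mem
      obtain ⟨w, hw, j, hj, rfl⟩ := Submodule.mem_sup.1 (ih hb)
      have hcJ : c ∈ J 1 := by simpa [J] using hc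
      obtain ⟨w', hw', j', hj', rfl⟩ := Submodule.mem_sup.1 (h1 hcJ)
      have hwI : w ∈ I ^ s := by
        have := sub_mem hb (Ideal.pow_le_pow_right (Nat.le_succ s) hj)
        rwa [add_sub_cancel_right] at this
      rw [show (w + j) * (w' + j') = w * w' + (w * j' + j * (w' + j')) by ring]
      refine add_mem (Submodule.mem_sup_left ?_) (Submodule.mem_sup_right (add_mem ?_ ?_))
      · rw [pow_succ]; exact Submodule.mul_mem_mul hw hw'
      · change _ ∈ I ^ (s + 2)
        rw [pow_add]; exact Ideal.mul_mem_mul hwI hj'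
      · change _ ∈ I ^ (s + 1 + 1)
        rw [pow_succ]; exact Ideal.mul_mem_mul hj hc
  -- Homogenisation: monomials of degree at most `s` in the `y i` are those of degree exactly `s` in
  -- `1` and the `y i`, indexed by `Sym (Fin (n + 1)) s`.
  let z : Fin (n + 1) → R := Fin.cons 1 y
  let W : Submodule k R := Submodule.span k (Set.range z)
  have hW' : W' ≤ W := Submodule.span_mono (by rintro _ ⟨i, rfl⟩; exact ⟨i.succ, rfl⟩)
  have hW1 : 1 ≤ W := by
    rw [Submodule.one_le]; exact Submodule.subset_span ⟨0, rfl⟩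
  have h3 (s : ℕ) : ⊤ ≤ W ^ s ⊔ J (s + 1) := by
    induction s with
    | zero => exact le_of_eq_of_le (by ext; simp [J]) (h2 0)
    | succ s ih =>
      refine ih.trans (sup_le ?_ ((h2 (s + 1)).trans ?_))
      · exact (pow_le_pow_right₀ hW1 (Nat.le_succ s)).trans le_sup_left
      · exact sup_le_sup_right (pow_le_pow_left₀ bot_le hW' _) _
  let q : R →ₗ[k] R ⧸ I ^ (s + 1) := (Ideal.Quotient.mkₐ k (I ^ (s + 1))).toLinearMap
  let g : Sym (Fin (n + 1)) s → R ⧸ I ^ (s + 1) := fun t ↦ q (t.1.map z).prod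
  have hg : Submodule.span k (Set.range g) = ⊤ := by
    rw [eq_top_iff]
    rintro a -
    obtain ⟨a, rfl⟩ := Ideal.Quotient.mk_surjective a
    obtain ⟨w, hw, j, hj, rfl⟩ := Submodule.mem_sup.1 (h3 s (Submodule.mem_top (x := a)))
    have hj0 : Ideal.Quotient.mk (I ^ (s + 1)) j = 0 := Ideal.Quotient.eq_zero_iff_mem.2 hj
    rw [map_add, hj0, add_zero]
    have : W ^ s ≤ Submodule.span k (Set.range fun t : Sym (Fin (n + 1)) s ↦ (t.1.map z).prod) := by
      rw [Submodule.span_pow]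
      exact Submodule.span_mono (Set.range_pow_subset_range_sym z s)
    have := Submodule.mem_map_of_mem (f := q) (this hw)
    rwa [Submodule.map_span, ← Set.range_comp] at this
  rw [← rank_top, ← hg]
  rw [← Set.image_univ, ← Finset.coe_univ, ← Finset.coe_image]
  refine (rank_span_finset_le _).trans (Nat.cast_le.2 (Finset.card_image_le.trans ?_))
  rw [Finset.card_univ, Sym.card_sym_eq_choose, Fintype.card_fin]
  simp
  

/-! ### The local ring at a smooth closed point -/

lemma IsAlgClosed.algebraMap_quotient_surjective {k S : Type*} [Field k] [IsAlgClosed k]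
    [CommRing S] [Algebra k S] [Algebra.FiniteType k S] (p : Ideal S) [p.IsMaximal] :
    Function.Surjective (algebraMap k (S ⧸ p)) := by
  let : Field (S ⧸ p) := Ideal.Quotient.field p
  have : Module.Finite k (S ⧸ p) := finite_of_finite_type_of_isJacobsonRing k (S ⧸ p)
  exact (IsAlgClosed.algebraMap_bijective_of_isIntegral (k := k) (K := S ⧸ p)).2

section SmoothPoint

variable {k S R : Type*} [Field k] [IsAlgClosed k] [CommRing S] [Algebra k S]
  (p : Ideal S) [p.IsMaximal] [CommRing R] [IsLocalRing R] [Algebra S R] [IsLocalization.AtPrime R p]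

open IsLocalRing

include p in
lemma IsLocalization.AtPrime.algebraMap_quotient_surjective [Algebra.FiniteType k S]
    [Algebra k R] [IsScalarTower k S R] :
    Function.Surjective (algebraMap k (R ⧸ maximalIdeal R)) := by
  intro a
  obtain ⟨b, rfl⟩ := (IsLocalization.AtPrime.equivQuotMaximalIdeal p R).surjective a
  obtain ⟨c, rfl⟩ := IsAlgClosed.algebraMap_quotient_surjective (k := k) p b
  refine ⟨c, ?_⟩
  change Ideal.Quotient.mk _ (algebraMap k R c) =
    IsLocalization.AtPrime.equivQuotMaximalIdeal p R (Ideal.Quotient.mk _ (algebraMap k S c))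
  rw [IsScalarTower.algebraMap_apply k S R]
  rfl

/-- Some localisation `S_f` with `f ∉ p` is standard smooth; coordinates at `p S_f` are carried to
`R` along `S_f → R`. -/
lemma Algebra.IsSmoothAt.exists_maximalIdeal_eq_span_sup_sq [Algebra.FinitePresentation k S]
    [Algebra.IsSmoothAt k p] :
    ∃ (d : ℕ) (y : Fin d → R), (d : WithBot ℕ∞) ≤ ringKrullDim S ∧
      maximalIdeal R = Ideal.span (Set.range y) ⊔ maximalIdeal R ^ 2 := by
  obtain ⟨f, hf, hfs⟩ := Algebra.IsSmoothAt.exists_notMem_isStandardSmooth k p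
  let S' := Localization.Away f
  let p' : Ideal S' := p.map (algebraMap S S')
  have hdisj : Disjoint (Submonoid.powers f : Set S) p := by
    rwa [Ideal.disjoint_powers_iff_notMem_of_isPrime]
  have hunder : p'.under S = p :=
    IsLocalization.under_map_of_isPrime_disjoint (Submonoid.powers f) S' inferInstance hdisj
  have hprime : p'.IsPrime :=
    IsLocalization.isPrime_of_isPrime_disjoint (Submonoid.powers f) S' p inferInstance hdisj
  have hmax0 : (p'.under S).IsMaximal := by rwa [hunder]
  have hmax : p'.IsMaximal := .of_isLocalization_of_disjoint (Submonoid.powers f)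
  obtain ⟨d, y, hd, hy⟩ := Algebra.IsStandardSmooth.exists_eq_span_sup_sq (k := k) p'
    (IsAlgClosed.algebraMap_quotient_surjective p')
  let θ : S' →+* R := IsLocalization.Away.lift f (g := algebraMap S R)
    (IsLocalization.map_units R (⟨f, hf⟩ : p.primeCompl))
  have hθ : p'.map θ = maximalIdeal R := by
    rw [Ideal.map_map, IsLocalization.Away.lift_comp, IsLocalization.AtPrime.map_eq_maximalIdeal p R]
  refine ⟨d, θ ∘ y, hd.trans ?_, ?_⟩
  · rw [← PrimeSpectrum.topologicalKrullDim_eq_ringKrullDim,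
      ← PrimeSpectrum.topologicalKrullDim_eq_ringKrullDim]
    exact (PrimeSpectrum.localization_comap_isInducing S'
      (Submonoid.powers f)).topologicalKrullDim_le
  · conv_lhs => rw [← hθ, hy, Ideal.map_sup, Ideal.map_pow, hθ, Ideal.map_span, ← Set.range_comp]

end SmoothPoint

/-- Artin–Rees for a principal ideal. -/
lemma Ideal.exists_forall_mem_pow_sub_of_mul_mem_pow {R : Type*} [CommRing R] [IsDomain R]
    [IsNoetherianRing R] (I : Ideal R) {w : R} (hw : w ≠ 0) :
    ∃ c : ℕ, ∀ (a : ℕ) (u : R), u * w ∈ I ^ a → u ∈ I ^ (a - c) := by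
  obtain ⟨c, hc⟩ := I.exists_pow_inf_eq_pow_smul (Ideal.span {w} : Submodule R R)
  refine ⟨c, fun a u hu ↦ ?_⟩
  rcases le_total a c with h | h
  · simp [Nat.sub_eq_zero_of_le h]
  -- Artin–Rees gives `I ^ a ∩ (w) ⊆ I ^ (a - c) w`, and `w` can be cancelled.
  have h1 : u * w ∈ I ^ (a - c) • (I ^ c • ⊤ ⊓ (Ideal.span {w} : Submodule R R)) := by
    rw [← hc a h]
    exact ⟨by simpa using hu, Ideal.mul_mem_left _ _ (Ideal.mem_span_singleton_self w)⟩
  have h2 : u * w ∈ I ^ (a - c) * Ideal.span {w} :=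
    Submodule.smul_mono le_rfl inf_le_right h1
  obtain ⟨z, hz, hzw⟩ := Ideal.mem_mul_span_singleton.1 h2
  rwa [← mul_right_cancel₀ hw hzw]

/-- The linear map `V → R ⧸ I` sending `f` to the class of `f * h` cannot be injective, for lack of
room in the target. -/
lemma Submodule.exists_ne_zero_mul_mem_of_rank_lt {k R K : Type u} [Field k] [CommRing R] [Field K]
    [Algebra k R] [Algebra R K] [Algebra k K] [IsScalarTower k R K]
    (hinj : Function.Injective (algebraMap R K)) (I : Ideal R) {N : ℕ}
    (hN : Module.rank k (R ⧸ I) ≤ N) (V : Submodule k K) (hV : N < Module.rank k V) (h : K)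
    (hreg : ∀ f ∈ V, f * h ∈ (algebraMap R K).range) :
    ∃ f ∈ V, f ≠ 0 ∧ ∃ a ∈ I, algebraMap R K a = f * h := by
  let i : R →ₗ[k] K := (IsScalarTower.toAlgHom k R K).toLinearMap
  let θ : V →ₗ[k] R := (LinearEquiv.ofInjective i hinj).symm.toLinearMap ∘ₗ
    ((LinearMap.mulRight k h).domRestrict V).codRestrict (LinearMap.range i) fun f ↦ hreg f f.2
  have hθ (f : V) : algebraMap R K (θ f) = f * h :=
    congrArg Subtype.val ((LinearEquiv.ofInjective i hinj).apply_symm_apply _)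
  let ψ : V →ₗ[k] R ⧸ I := (Ideal.Quotient.mkₐ k I).toLinearMap ∘ₗ θ
  have hψ : ¬ Function.Injective ψ := fun H ↦
    ((LinearMap.rank_le_of_injective ψ H).trans hN).not_gt hV
  rw [← LinearMap.ker_eq_bot, Submodule.eq_bot_iff] at hψ
  push Not at hψ
  obtain ⟨f, hf, hf0⟩ := hψ
  exact ⟨f, f.2, by simpa using hf0, θ f, Ideal.Quotient.eq_zero_iff_mem.1 hf, hθ f⟩

open Filter Topology in
-- `n!` times the binomial coefficient is at most `(m n + n + C) ^ n`, and dividing by `m ^ n` gives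
-- the limit `n ^ n` whatever `C` is.
lemma exists_choose_lt_of_pow_lt_limsup (n C : ℕ) (a : ℕ → ℕ∞)
    (ha : (n : ℝ≥0∞) ^ n <
      limsup (fun m : ℕ ↦ (n ! : ℝ≥0∞) * (a m : ℝ≥0∞) / (m : ℝ≥0∞) ^ n) atTop) :
    ∃ m : ℕ, 0 < m ∧ (((n + (m * n + C)).choose (m * n + C) : ℕ) : ℕ∞) < a m := by
  by_contra! H
  refine ha.not_ge ?_
  have hlim : Tendsto (fun m : ℕ ↦ (((n + C : ℕ) : ℝ≥0∞) / m + n) ^ n) atTop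
      (𝓝 ((n : ℝ≥0∞) ^ n)) := by
    have h1 : Tendsto (fun m : ℕ ↦ ((n + C : ℕ) : ℝ≥0∞) / m) atTop (𝓝 0) := by
      have := ENNReal.Tendsto.const_div (a := ((n + C : ℕ) : ℝ≥0∞)) ENNReal.tendsto_nat_nhds_top
        (Or.inr (ENNReal.natCast_ne_top _))
      rwa [ENNReal.div_top] at this
    have h2 := ENNReal.Tendsto.pow (n := n) (h1.add_const (n : ℝ≥0∞))
    rwa [zero_add] at h2
  rw [← hlim.limsup_eq]
  refine limsup_le_limsup ?_
  filter_upwards [eventually_gt_atTop 0] with m hm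
  have hm0 : (m : ℝ≥0∞) ≠ 0 := by exact_mod_cast hm.ne'
  have h1 : (a m : ℝ≥0∞) ≤ ((n + (m * n + C)).choose (m * n + C) : ℕ) := by
    have := ENat.toENNReal_mono (H m hm)
    simpa using this
  have h2 : n ! * (n + (m * n + C)).choose (m * n + C) ≤ (n + C + m * n) ^ n := by
    rw [← Nat.choose_symm_add, ← Nat.descFactorial_eq_factorial_mul_choose]
    exact (Nat.descFactorial_le_pow _ _).trans (Nat.pow_le_pow_left (by omega) _)
  calc (n ! : ℝ≥0∞) * (a m : ℝ≥0∞) / (m : ℝ≥0∞) ^ n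
      ≤ ((n + C + m * n : ℕ) : ℝ≥0∞) ^ n / (m : ℝ≥0∞) ^ n := by
        gcongr
        calc (n ! : ℝ≥0∞) * (a m : ℝ≥0∞)
            ≤ n ! * ((n + (m * n + C)).choose (m * n + C) : ℕ) := by gcongr
          _ ≤ _ := by exact_mod_cast h2
    _ = (((n + C : ℕ) : ℝ≥0∞) / m + n) ^ n := by
        rw [ENNReal.div_eq_inv_mul, ENNReal.inv_pow, ← mul_pow, ← ENNReal.div_eq_inv_mul]
        congr 1
        push_cast
        rw [ENNReal.add_div]
        congr 1
        rw [mul_comm, ENNReal.mul_div_cancel_right hm0 (ENNReal.natCast_ne_top m)]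

/-! ### From sections to divisors -/

namespace QDivisor

variable {X : Scheme.{u}} {k : Type u} [Field k]

/-- The inclusion of the constants `k → 𝒪_{X,x}` for a scheme `X` over `k`. -/
noncomputable def stalkConstants (π : X ⟶ Spec (.of k)) (x : X) : k →+* X.presheaf.stalk x :=
  (X.presheaf.germ ⊤ x trivial).hom.comp
    (π.appTop.hom.comp (Scheme.ΓSpecIso (.of k)).inv.hom)

/-- Local coordinates at a smooth closed point. -/
lemma exists_maximalIdeal_stalk_eq_span_sup_sq [IsAlgClosed k] (π : X ⟶ Spec (.of k))
    [LocallyOfFinitePresentation π] (x : X) (hx : IsClosed ({x} : Set X))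
    (hxs : x ∈ π.smoothLocus) :
    letI := (stalkConstants π x).toAlgebra
    Function.Surjective
      (algebraMap k (X.presheaf.stalk x ⧸ IsLocalRing.maximalIdeal (X.presheaf.stalk x))) ∧
    ∃ (d : ℕ) (y : Fin d → X.presheaf.stalk x), (d : WithBot ℕ∞) ≤ topologicalKrullDim X ∧
      IsLocalRing.maximalIdeal (X.presheaf.stalk x) =
        Ideal.span (Set.range y) ⊔ IsLocalRing.maximalIdeal (X.presheaf.stalk x) ^ 2 := by
  obtain ⟨_, ⟨V, hV, rfl⟩, hxV, -⟩ :=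
    X.isBasis_affineOpens.exists_subset_of_mem_open (Set.mem_univ x) isOpen_univ
  have hU : IsAffineOpen (⊤ : (Spec (.of k)).Opens) := isAffineOpen_top _
  have hVU : V ≤ π ⁻¹ᵁ ⊤ := le_top
  -- Smoothness and finite presentation are given over `Γ(Spec k, ⊤)`; this isomorphism transfers
  -- them to `k`.
  let iso := (Scheme.ΓSpecIso (.of k)).symm.commRingCatIsoToRingEquiv
  have hfp := π.finitePresentation_appLE hU hV hVU
  have hsm := (formallySmooth_stalkMap_iff ⊤ hU V hV hVU hxV).1 hxs
  let p := (hV.primeIdealOf ⟨x, hxV⟩).asIdeal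
  have hp : p.IsMaximal := hV.primeIdealOf_isMaximal_of_isClosed ⟨x, hxV⟩ hx
  let algk : Algebra k Γ(Spec (.of k), ⊤) := iso.toRingHom.toAlgebra
  let algU : Algebra Γ(Spec (.of k), ⊤) Γ(X, V) := (π.appLE ⊤ V hVU).hom.toAlgebra
  let algV : Algebra k Γ(X, V) := ((π.appLE ⊤ V hVU).hom.comp iso.toRingHom).toAlgebra
  have tower : IsScalarTower k Γ(Spec (.of k), ⊤) Γ(X, V) := .of_algebraMap_eq' rfl
  have hfp' : Algebra.FinitePresentation k Γ(X, V) :=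
    hfp.comp (RingHom.FinitePresentation.of_bijective iso.bijective)
  have hks : Algebra.FormallySmooth k Γ(Spec (.of k), ⊤) :=
    Algebra.FormallySmooth.of_equiv (AlgEquiv.ofRingEquiv (f := iso) fun _ ↦ rfl)
  have hsm' : Algebra.IsSmoothAt Γ(Spec (.of k), ⊤) p := hsm
  have hsm'' : Algebra.IsSmoothAt k p :=
    Algebra.FormallySmooth.comp k Γ(Spec (.of k), ⊤) (Localization.AtPrime p)
  let algR : Algebra Γ(X, V) (X.presheaf.stalk x) := (X.presheaf.germ V x hxV).hom.toAlgebra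
  have hloc : IsLocalization.AtPrime (X.presheaf.stalk x) p :=
    hV.isLocalization_stalk ⟨x, hxV⟩
  let algkR := (stalkConstants π x).toAlgebra
  have tower' : IsScalarTower k Γ(X, V) (X.presheaf.stalk x) := by
    refine .of_algebraMap_eq' ?_
    ext c
    exact (X.presheaf.germ_res_apply (homOfLE hVU) x hxV _).symm
  refine ⟨IsLocalization.AtPrime.algebraMap_quotient_surjective p, ?_⟩
  obtain ⟨d, y, hd, hy⟩ := Algebra.IsSmoothAt.exists_maximalIdeal_eq_span_sup_sq
    (k := k) (R := X.presheaf.stalk x) p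
  refine ⟨d, y, hd.trans ?_, hy⟩
  rw [← PrimeSpectrum.topologicalKrullDim_eq_ringKrullDim]
  change topologicalKrullDim (Spec Γ(X, V)) ≤ _
  rw [← IsHomeomorph.topologicalKrullDim_eq _ hV.isoSpec.hom.homeomorph.isHomeomorph]
  exact topologicalKrullDim_subspace_le X V

variable [IsIntegral X]

lemma algebraMap_comp_stalkConstants (π : X ⟶ Spec (.of k)) (x : X) :
    (algebraMap (X.presheaf.stalk x) X.functionField).comp (stalkConstants π x) =
      constants π := by
  have : Nonempty (⊤ : X.Opens) := ⟨⟨genericPoint X, trivial⟩⟩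
  ext c
  exact X.algebraMap_germ_eq_germToFunctionField (U := ⊤) (x := x) trivial _

/-- For `D = M + (1/m)(f)`, the multiple `r m D` is the class of the effective divisor `r (f) + B`,
whose local equation `f ^ r g` lies in `𝔪_x ^ s`. Hence `mult_x D ≥ s / (r m) > n`. -/
lemma exists_effective_of_section (M : QCartierDivisor X) {n r m s : ℕ} (hr : 0 < r) (hm : 0 < m)
    (B : CartierDivisor X) (hB : ofCartier B = (r * m) • M) (f : (X.functionField)ˣ)
    (hreg : ∀ (y : X) (g : (X.functionField)ˣ), IsLocalEquation B y g →
      RegularAt y (f.1 ^ r * g.1)) (x : X) (g : (X.functionField)ˣ) (hg : IsLocalEquation B x g)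
    (a : X.presheaf.stalk x) (has : a ∈ IsLocalRing.maximalIdeal (X.presheaf.stalk x) ^ s)
    (ha : algebraMap (X.presheaf.stalk x) X.functionField a = f.1 ^ r * g.1)
    (hs : n * (r * m) < s) :
    ∃ D : QCartierDivisor X, IsEffective D ∧ QLinearlyEquivalent D M ∧ (n : ℝ≥0∞) < mult D x := by
  let L := r • principal f + B
  have hrm : 0 < r * m := Nat.mul_pos hr hm
  let D : QCartierDivisor X := M + (m : ℚ)⁻¹ • ofCartier (principal f)
  have hmD : m • (D - M) = ofCartier (principal f) := by
    rw [add_sub_cancel_left, ← Nat.cast_smul_eq_nsmul ℚ, smul_smul,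
      mul_inv_cancel₀ (by exact_mod_cast hm.ne'), one_smul]
  have hDL : (r * m) • D = ofCartier L := by
    have : D = M + (D - M) := by abel
    rw [this, smul_add, mul_smul r m (D - M), hmD, ofCartier_add, ofCartier_nsmul, hB, add_comm]
  have hL : L.IsEffective := by
    intro y h hh
    obtain ⟨b, hb⟩ := exists_isLocalEquation B y
    have h1 := ((isLocalEquation_principal f y).nsmul r).add hb
    have h2 : RegularAt y (1 * ((f ^ r * b : (X.functionField)ˣ) : X.functionField)) := by
      simpa using hreg y b hb
    simpa using (regularAt_mul_iff h1 hh 1).1 h2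
  refine ⟨D, ⟨r * m, L, hrm, hL, hDL⟩, ⟨m, f, hm, hmD⟩, ?_⟩
  have h1 : (s : ℕ∞) ≤ cartierMult L x :=
    le_iSup₂_of_le s ⟨a, has, f ^ r * g, ((isLocalEquation_principal f x).nsmul r).add hg,
      by simpa using ha⟩ le_rfl
  have h2 : (cartierMult L x : ℝ≥0∞) / (r * m : ℕ) ≤ mult D x :=
    le_iSup_of_le (r * m) (le_iSup₂_of_le L ⟨hrm, hL, hDL⟩ le_rfl)
  refine lt_of_lt_of_le ?_ h2
  rw [ENNReal.lt_div_iff_mul_lt (Or.inl (by exact_mod_cast hrm.ne'))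
    (Or.inl (ENNReal.natCast_ne_top _))]
  calc (n : ℝ≥0∞) * (r * m : ℕ) = ((n * (r * m) : ℕ) : ℝ≥0∞) := by push_cast; rfl
    _ < (s : ℝ≥0∞) := by exact_mod_cast hs
    _ ≤ (cartierMult L x : ℝ≥0∞) := by simpa using ENat.toENNReal_mono h1

lemma regularAt_of_pow (hX : IsNormalScheme X) {x : X} {f : X.functionField} {N : ℕ} (hN : 0 < N)
    (h : RegularAt x (f ^ N)) : RegularAt x f := by
  have := hX x
  obtain ⟨a, ha⟩ := h
  exact IsIntegrallyClosed.isIntegral_iff.1 (IsIntegral.of_pow hN (ha ▸ isIntegral_algebraMap))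

/-- If `r M` is the class of `B`, then `f ^ r ∈ H⁰(X, 𝒪_X(m B))` for every section `f` of the
round-down of `m M`. -/
lemma IsRoundDownSection.regularAt_pow_mul (hX : IsNormalScheme X) {M : QCartierDivisor X}
    {r m : ℕ} {B : CartierDivisor X} (hB : r • M = ofCartier B) {f : X.functionField}
    (hf : IsRoundDownSection (m • M) f) (y : X) (g : (X.functionField)ˣ)
    (hg : IsLocalEquation (m • B) y g) : RegularAt y (f ^ r * g.1) := by
  obtain ⟨N, B', hN, hB', h⟩ := (isRoundDownSection_iff _ f).1 hf
  -- Both divisors represent `N r m M`, so they agree up to torsion, which `t` kills.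
  obtain ⟨t, ht, htB⟩ := exists_nsmul_eq_of_ofCartier_eq (L := N • m • B) (M := r • B') (by
    rw [ofCartier_nsmul, ofCartier_nsmul, ofCartier_nsmul, ← hB, ← hB']
    simp only [smul_smul]
    congr 1
    ring)
  obtain ⟨b, hb⟩ := exists_isLocalEquation B' y
  have e1 := (hg.nsmul N).nsmul t
  have e2 := (hb.nsmul r).nsmul t
  rw [← htB] at e2
  have h1 := ((h y b hb).pow r).pow t
  have h2 : RegularAt y (f ^ (N * r * t) * (((b ^ r) ^ t : (X.functionField)ˣ) :
      X.functionField)) := by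
    convert h1 using 1
    push_cast
    ring
  rw [regularAt_mul_iff e2 e1] at h2
  -- The `N t`-th power of `f ^ r g` is regular; normality extracts the root.
  refine regularAt_of_pow hX (Nat.mul_pos hN ht) ?_
  convert h2 using 1
  push_cast
  ring

/-- If `V` has more elements than the conditions for vanishing to order `s + 1` at a smooth closed
point, then some nonzero element of `V` satisfies these conditions. -/
lemma exists_ne_zero_mul_mem_maximalIdeal_pow [IsAlgClosed k] (π : X ⟶ Spec (.of k))
    [LocallyOfFinitePresentation π] {n : ℕ} (hn : topologicalKrullDim X = n)
    (x : X) (hx : IsClosed ({x} : Set X)) (hxs : x ∈ π.smoothLocus) :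
    letI := functionFieldAlgebra π
    ∀ (V : Submodule k X.functionField) (h : X.functionField) (s : ℕ),
      (((n + s).choose s : ℕ) : Cardinal) < Module.rank k V → (∀ f ∈ V, RegularAt x (f * h)) →
      ∃ f ∈ V, f ≠ 0 ∧ ∃ a ∈ IsLocalRing.maximalIdeal (X.presheaf.stalk x) ^ (s + 1),
        algebraMap (X.presheaf.stalk x) X.functionField a = f * h := by
  let algK := functionFieldAlgebra π
  let algR := (stalkConstants π x).toAlgebra
  have tower : IsScalarTower k (X.presheaf.stalk x) X.functionField :=
    .of_algebraMap_eq' (algebraMap_comp_stalkConstants π x).symm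
  obtain ⟨hk, d, y, hd, hy⟩ := exists_maximalIdeal_stalk_eq_span_sup_sq π x hx hxs
  have hdn : d ≤ n := by
    rw [hn] at hd
    exact_mod_cast hd
  intro V h s hV hreg
  have h1 := Ideal.rank_quotient_pow_succ_le _ hk y hy s
  have h2 : (d + s).choose s ≤ (n + s).choose s := Nat.choose_le_choose _ (by omega)
  exact Submodule.exists_ne_zero_mul_mem_of_rank_lt
    (IsFractionRing.injective (X.presheaf.stalk x) X.functionField) _
    (h1.trans (Nat.cast_le.2 h2)) V hV h hreg

/-- On a normal variety there is a common denominator for the sections of the round-downs of the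
multiples of `M`, up to which their orders of vanishing are those of their divisors. -/
lemma exists_const_forall_roundDownSection (hX : IsNormalScheme X) [IsLocallyNoetherian X]
    {M : QCartierDivisor X} {r : ℕ} (hr : 0 < r) {B : CartierDivisor X}
    (hB : r • M = ofCartier B) (x : X) {b : (X.functionField)ˣ} (hb : IsLocalEquation B x b) :
    ∃ c : ℕ, ∀ m : ℕ, ∃ h : X.functionField,
      (∀ f, IsRoundDownSection (m • M) f → RegularAt x (f * h)) ∧
      ∀ f, IsRoundDownSection (m • M) f → ∀ (s : ℕ),
        ∀ a ∈ IsLocalRing.maximalIdeal (X.presheaf.stalk x) ^ s,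
        algebraMap (X.presheaf.stalk x) X.functionField a = f * h →
        ∃ u ∈ IsLocalRing.maximalIdeal (X.presheaf.stalk x) ^ (s * r - c),
          algebraMap (X.presheaf.stalk x) X.functionField u = f ^ r * ((b ^ m :
            (X.functionField)ˣ) : X.functionField) := by
  let R := X.presheaf.stalk x
  let K := X.functionField
  let i := algebraMap R K
  have hinj : Function.Injective i := IsFractionRing.injective R K
  obtain ⟨b₁, b₂, hb₂, hdiv⟩ := IsFractionRing.div_surjective (A := R) b.1
  have hb₂0 : i b₂ ≠ 0 := fun H ↦ nonZeroDivisors.ne_zero hb₂ (hinj (H.trans (map_zero i).symm))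
  have hbb : b.1 * i b₂ = i b₁ := by rw [← hdiv]; exact div_mul_cancel₀ _ hb₂0
  have hb₁ : b₁ ≠ 0 := by
    rintro rfl
    rw [map_zero] at hbb
    exact (mul_ne_zero b.ne_zero hb₂0) hbb
  -- Artin–Rees is applied to `(b₁ b₂) ^ r`, where `b = b₁ / b₂`. This element does not involve `m`,
  -- so neither does `c`.
  obtain ⟨c, hc⟩ := (IsLocalRing.maximalIdeal R).exists_forall_mem_pow_sub_of_mul_mem_pow
    (pow_ne_zero r (mul_ne_zero hb₁ (nonZeroDivisors.ne_zero hb₂)))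
  -- Ideally `h` would be `b ^ (m / r)` with a rational exponent. With `m = r q + t`, the missing
  -- factor `b ^ (t / r)` is replaced by `b₁`, since `b₁ ^ r = b ^ t b₂ ^ t b₁ ^ (r - t)` is a
  -- regular multiple of `b ^ t`.
  refine ⟨c, fun m ↦ ⟨b.1 ^ (m / r) * i b₁, ?_⟩⟩
  obtain ⟨q, t, ht, rfl⟩ : ∃ q t, t < r ∧ m = r * q + t :=
    ⟨m / r, m % r, Nat.mod_lt _ hr, (Nat.div_add_mod m r).symm⟩
  have hq : (r * q + t) / r = q := by
    rw [Nat.mul_add_div hr, Nat.div_eq_of_lt ht, add_zero]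
  rw [hq]
  obtain ⟨e, rfl⟩ := Nat.exists_eq_add_of_lt ht
  set r' := t + e + 1 with hr'
  have hu (f : K) (hf : IsRoundDownSection ((r' * q + t) • M) f) :
      RegularAt x (f ^ r' * b.1 ^ (r' * q + t)) := by
    have := hf.regularAt_pow_mul hX hB x _ (hb.nsmul (r' * q + t))
    simpa using this
  have key (f : K) : (f * (b.1 ^ q * i b₁)) ^ r' =
      (f ^ r' * b.1 ^ (r' * q + t)) * i (b₂ ^ t * b₁ ^ (e + 1)) := by
    rw [map_mul, map_pow, map_pow]
    have : i b₁ ^ r' = (b.1 * i b₂) ^ t * i b₁ ^ (e + 1) := by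
      rw [hbb, ← pow_add, hr', add_assoc]
    have h2 : b.1 ^ (r' * q + t) = (b.1 ^ q) ^ r' * b.1 ^ t := by
      rw [pow_add, mul_comm r' q, pow_mul]
    rw [mul_pow, mul_pow, this, h2]
    ring
  refine ⟨fun f hf ↦ regularAt_of_pow hX hr ?_, fun f hf s a ha haf ↦ ?_⟩
  · rw [key]
    exact (hu f hf).mul ⟨_, rfl⟩
  · obtain ⟨u, hu⟩ := hu f hf
    refine ⟨u, hc _ _ ?_, by simpa using hu⟩
    -- `key` says `a ^ r = u b₂ ^ t b₁ ^ (r - t)`; multiplying by the complementary powers gives a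
    -- factor independent of `t`, to which the choice of `c` applies.
    have h1 : u * (b₁ * b₂) ^ r' = a ^ r' * (b₁ ^ t * b₂ ^ (e + 1)) := by
      apply hinj
      rw [map_mul, map_mul, map_pow i a]
      change i u * _ = algebraMap R K a ^ r' * _
      rw [haf, key, ← hu]
      change i u * _ = i u * _ * _
      simp only [← map_mul]
      congr 1
      rw [hr']
      ring
    rw [h1, pow_mul]
    exact Ideal.mul_mem_right _ _ (Ideal.pow_mem_pow ha r')

end QDivisor

/-! ### The dimension count -/

theorem mainTheorem10 {k : Type u} [Field k] [IsAlgClosed k] (X : Scheme.{u}) [IsIntegral X]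
    (π : X ⟶ Spec (.of k)) [IsProper π] (n : ℕ) (hn : topologicalKrullDim X = n)
    (M : QDivisor.QCartierDivisor X) (hM : (n : ℝ≥0∞) ^ n < QDivisor.volume π n M)
    (x : X) (hx : IsClosed ({x} : Set X)) (hxs : x ∈ π.smoothLocus) :
    ∃ D : QDivisor.QCartierDivisor X, QDivisor.IsEffective D ∧
      QDivisor.QLinearlyEquivalent D M ∧ (n : ℝ≥0∞) < QDivisor.mult D x := by
  open QDivisor in
  have hnoeth : IsLocallyNoetherian X := LocallyOfFiniteType.isLocallyNoetherian π
  have hvanish := exists_ne_zero_mul_mem_maximalIdeal_pow π hn x hx hxs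
  by_cases hX : IsNormalScheme X
  · obtain ⟨r, B, hr, hB⟩ := exists_ofCartier_eq M
    obtain ⟨b, hb⟩ := exists_isLocalEquation B x
    obtain ⟨c, hc⟩ := exists_const_forall_roundDownSection hX hr hB x hb
    -- The extra `c` orders of vanishing pay for the Artin–Rees loss.
    obtain ⟨m, hm, hlt⟩ := exists_choose_lt_of_pow_lt_limsup n c _ hM
    rw [h0RoundDown, dif_pos hX, Cardinal.natCast_lt_toENat] at hlt
    obtain ⟨h, hreg, hmul⟩ := hc m
    obtain ⟨f, hf, hf0, a, ha, haf⟩ := hvanish _ h _ hlt hreg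
    obtain ⟨u, hu, huf⟩ := hmul f hf _ a ha haf
    refine exists_effective_of_section M hr hm (m • B) ?_ (Units.mk0 f hf0)
      (fun y g hg ↦ IsRoundDownSection.regularAt_pow_mul hX hB hf y g hg) x (b ^ m) (hb.nsmul m)
      u hu huf ?_
    · rw [ofCartier_nsmul, ← hB, smul_smul, mul_comm]
    -- `(m n + c + 1) r - c > n r m` because `r ≥ 1`.
    · obtain ⟨r, rfl⟩ := Nat.exists_eq_add_of_lt hr
      rw [Nat.lt_sub_iff_add_lt]
      nlinarith [Nat.zero_le (c * r)]
  -- Here a Cartier divisor `L` represents `m M` itself, so its local equation serves as the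
  -- multiplier, with `r = 1` and no loss.
  · obtain ⟨m, hm, hlt⟩ := exists_choose_lt_of_pow_lt_limsup n 0 _ hM
    rw [h0RoundDown, dif_neg hX, lt_iSup_iff] at hlt
    obtain ⟨L, hlt⟩ := hlt
    obtain ⟨hL, hlt⟩ := lt_iSup_iff.1 hlt
    rw [h0, Cardinal.natCast_lt_toENat] at hlt
    obtain ⟨g, hg⟩ := exists_isLocalEquation L x
    obtain ⟨f, hf, hf0, a, ha, haf⟩ := hvanish _ g.1 _ hlt fun f hf ↦ hf x g hg
    refine exists_effective_of_section M one_pos hm L (by rw [hL, one_mul]) (Units.mk0 f hf0)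
      (fun y g hg ↦ ?_) x g hg a ha (by simpa using haf) ?_
    · simpa using hf y g hg
    · rw [one_mul, mul_comm]
      omega
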